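/- Let $(X,d)$ be a (possibly infinite) metric space. Write $E(X,d)$ for the set of all $f\colon X\to\mathbb R$ with $f(x)=\sup_{y\in X}(d(x,y)-f(y))$ for all $x\in X$, endowed with the metric $d_\infty(f,g)=\|f-g\|_\infty$. Any two elements of $E(X,d)$ differ by a bounded function, and $x\mapsto d_x:=d(x,\cdot)$ embeds $X$ isometrically into $E(X,d)$. For $f\in\mathbb R^X$ let $A(f)$ be the set of unordered pairs $\{x,y\}$ (possibly $x=y$) with $f(x)+f(y)=d(x,y)$; for a set $A$ of such pairs let $H(A)=\{g\in\mathbb R^X: g(x)+g(y)=d(x,y)\text{ for all }\{x,y\}\in A\}$ and $\operatorname{rank}(A)=\dim H(A)\in\mathbb N\cup\{0,\infty\}$. Let $E'(X,d)$ be the set of all $f\in\mathbb R^X$ with $f(x)+f(y)\ge d(x,y)$ for all $x,y\in X$ and $\bigcup A(f)=X$. The space $(X,d)$ satisfies the local rank condition (LRC) if for every $f\in E(X,d)$ there are $\varepsilon,N>0$ such that $\operatorname{rank}(A(g))\le N$ for all $g\in E'(X,d)$ with $\|f-g\|_\infty<\varepsilon$. For $f\in E(X,d)$ the cell of $f$ is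 $[f]=E(X,d)\cap H(A(f))$. A gate of $x\in X$ in $[f]$ is an element $\gamma\in[f]$ with $d_\infty(d_x,g)=d_\infty(d_x,\gamma)+d_\infty(\gamma,g)$ for all $g\in[f]$; it is unique if it exists, and is then denoted $\gamma^x$. The cell $[f]$ is called $X$-gated if every $x\in X$ has a gate in $[f]$; in this case $G([f])=\{\gamma^x:x\in X\}$. A metric space $(Y,\rho)$ is called antipodal if there is an involution $\sigma\colon Y\to Y$ (that is, $\sigma\circ\sigma=\mathrm{id}$) with $\rho(x,\sigma(x))=\rho(x,y)+\rho(y,\sigma(x))$ for all $x,y\in Y$. **Theorem.** Let $(X,d)$ be a metric space with integer-valued metric satisfying the (LRC), and let $f\in E(X,d)$ be such that $[f]$ is $X$-gated. Then: (i) $(G([f]),d_\infty)$ is an antipodal metric space. (ii) The map $\Phi\colon([f],d_\infty)\to E(G([f]),d_\infty)$ given by $$g\mapsto\bigl(\gamma^x\mapsto g(x)-\gamma^x(x)\bigr)$$ is well defined, is a bijective isometry, and is an isomorphism of polytopes: $[f]\subset\mathbb R^X$ and $E(G([f]),d_\infty)\subset\mathbb R^{G([f])}$ are convex hulls of finite sets,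 $\Phi$ is the restriction of an affine map that is injective on the affine hull of $[f]$, and a subset of $[f]$ is a face of $[f]$ if and only if its image under $\Phi$ is a face of $E(G([f]),d_\infty)$. -/

import Mathlib

/-! ### Isbell's injective hull -/

/-- `f` lies in `E(X,d)`: for every `x`, `f x` is the supremum of `d(x,y) - f(y)` over `y ∈ X`. -/
def IsExtremal {X : Type*} [MetricSpace X] (f : X → ℝ) : Prop :=
  ∀ x, IsLUB (Set.range fun y => dist x y - f y) (f x)

/-- The sup-distance `‖f - g‖_∞` of two real functions (only used when `f - g` is bounded). -/
noncomputable def supDist {X : Type*} (f g : X → ℝ) : ℝ := ⨆ x, |f x - g x|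

/-- The injective hull `E(X,d)`. -/
def InjHull (X : Type*) [MetricSpace X] : Type _ := {f : X → ℝ // IsExtremal f}

instance InjHull.instCoeFun {X : Type*} [MetricSpace X] :
    CoeFun (InjHull X) (fun _ => X → ℝ) := ⟨Subtype.val⟩

theorem IsExtremal.dist_le_add {X : Type*} [MetricSpace X] {f : X → ℝ} (hf : IsExtremal f)
    (x y : X) : dist x y ≤ f x + f y := by
  have := (hf x).1 ⟨y, rfl⟩
  simp only at this
  linarith

theorem IsExtremal.le_add_dist {X : Type*} [MetricSpace X] {f : X → ℝ} (hf : IsExtremal f)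
    (x y : X) : f x ≤ f y + dist x y := by
  refine (hf x).2 ?_
  rintro _ ⟨z, rfl⟩
  have h1 := hf.dist_le_add y z
  have h2 := dist_triangle x y z
  simp only
  linarith

theorem IsExtremal.bddAbove_abs_sub {X : Type*} [MetricSpace X] {f g : X → ℝ}
    (hf : IsExtremal f) (hg : IsExtremal g) : BddAbove (Set.range fun x => |f x - g x|) := by
  rcases isEmpty_or_nonempty X with h | ⟨⟨y⟩⟩
  · simp
  · refine ⟨f y + g y, ?_⟩
    rintro _ ⟨x, rfl⟩
    have h1 := hf.dist_le_add x y
    have h2 := hg.dist_le_add x y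
    have h3 := hf.le_add_dist x y
    have h4 := hg.le_add_dist x y
    simp only
    rw [abs_le]
    constructor <;> linarith

/-- `E(X,d)` with the metric `d_∞(f,g) = ‖f - g‖_∞`. -/
noncomputable instance InjHull.instMetricSpace {X : Type*} [MetricSpace X] :
    MetricSpace (InjHull X) where
  dist f g := supDist f.1 g.1
  dist_self f := by simp [supDist]
  dist_comm f g := by simp only [supDist, abs_sub_comm]
  dist_triangle f g h := by
    rcases isEmpty_or_nonempty X with hX | hX
    · simp [supDist]
    · refine ciSup_le fun x => (abs_sub_le _ (g.1 x) _).trans ?_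
      exact add_le_add (le_ciSup (f.2.bddAbove_abs_sub g.2) x)
        (le_ciSup (g.2.bddAbove_abs_sub h.2) x)
  eq_of_dist_eq_zero := by
    intro f g hfg
    change supDist f.1 g.1 = 0 at hfg
    refine Subtype.ext (funext fun x => ?_)
    have h := le_ciSup (f.2.bddAbove_abs_sub g.2) x
    have h0 : |f.1 x - g.1 x| ≤ 0 := h.trans hfg.le
    exact sub_eq_zero.1 (abs_nonpos_iff.1 h0)

/-- The canonical embedding `x ↦ d_x = d(x, ·)` of `X` into `E(X,d)`. -/
def InjHull.embed {X : Type*} [MetricSpace X] (x : X) : InjHull X :=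
  ⟨fun y => dist x y, fun z => by
    constructor
    · rintro _ ⟨y, rfl⟩
      have := dist_triangle z x y
      rw [dist_comm z x] at this
      simp only
      linarith
    · intro b hb
      have := hb ⟨x, rfl⟩
      simpa [dist_comm] using this⟩

/-! ### Tight pairs, rank, cells, the local rank condition -/

/-- `A(f)`: the unordered pairs `{x,y}` (possibly `x = y`) with `f(x) + f(y) = d(x,y)`. -/
def tightPairs {X : Type*} [MetricSpace X] (f : X → ℝ) : Set (Sym2 X) :=
  {e | ∃ x y : X, e = s(x, y) ∧ f x + f y = dist x y}

/-- `E'(X,d)`: the `f` with `f(x) + f(y) ≥ d(x,y)` for all `x, y` and `⋃ A(f) = X`. -/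
def IsTightExtremal {X : Type*} [MetricSpace X] (f : X → ℝ) : Prop :=
  (∀ x y, dist x y ≤ f x + f y) ∧ ∀ x : X, ∃ e ∈ tightPairs f, x ∈ e

/-- The affine subspace `H(A) = {g : g(x) + g(y) = d(x,y) for all {x,y} ∈ A}` of `ℝ^X`. -/
def tightSubspace {X : Type*} [MetricSpace X] (A : Set (Sym2 X)) :
    AffineSubspace ℝ (X → ℝ) where
  carrier := {g | ∀ x y : X, s(x, y) ∈ A → g x + g y = dist x y}
  smul_vsub_vadd_mem' := by
    intro c p q r hp hq hr x y hxy
    have h1 := hp x y hxy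
    have h2 := hq x y hxy
    have h3 := hr x y hxy
    simp only [vsub_eq_sub, vadd_eq_add, Pi.add_apply, Pi.smul_apply, Pi.sub_apply, smul_eq_mul]
    linear_combination c * h1 - c * h2 + h3

/-- `rank(A) = dim H(A) ∈ ℕ ∪ {∞}`. -/
noncomputable def tightRank {X : Type*} [MetricSpace X] (A : Set (Sym2 X)) : ℕ∞ :=
  Cardinal.toENat (Module.rank ℝ (tightSubspace A).direction)

/-- The local rank condition (LRC). -/
def LocalRankCondition (X : Type*) [MetricSpace X] : Prop :=
  ∀ f : X → ℝ, IsExtremal f → ∃ ε : ℝ, 0 < ε ∧ ∃ N : ℕ, ∀ g : X → ℝ,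
    IsTightExtremal g → supDist f g < ε → tightRank (tightPairs g) ≤ N

/-- The cell `[f] = E(X,d) ∩ H(A(f))`. -/
def cell {X : Type*} [MetricSpace X] (f : InjHull X) : Set (InjHull X) :=
  {g | (g : X → ℝ) ∈ tightSubspace (tightPairs (f : X → ℝ))}

/-! ### Gates and antipodal spaces -/

/-- `γ` is a gate of `x` in `Z ⊆ Y`, with respect to the map `i : X → Y`. -/
def IsGate {X Y : Type*} [MetricSpace Y] (i : X → Y) (Z : Set Y) (x : X) (γ : Y) : Prop :=
  γ ∈ Z ∧ ∀ z ∈ Z, dist (i x) z = dist (i x) γ + dist γ z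

/-- `Z ⊆ Y` is `X`-gated. -/
def IsGated {X Y : Type*} [MetricSpace Y] (i : X → Y) (Z : Set Y) : Prop :=
  ∀ x : X, ∃ γ : Y, IsGate i Z x γ

/-- The set of all `X`-gates of `Z`. -/
def gates {X Y : Type*} [MetricSpace Y] (i : X → Y) (Z : Set Y) : Set Y :=
  {γ | ∃ x : X, IsGate i Z x γ}

/-- A metric space is antipodal if it has an involution `σ` such that every point lies between
`x` and `σ x`, for every `x`. -/
def IsAntipodal (X : Type*) [MetricSpace X] : Prop :=
  ∃ σ : X → X, Function.Involutive σ ∧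
    ∀ x y : X, dist x (σ x) = dist x y + dist y (σ x)

/-! ### Polytopes -/

/-- A (convex) polytope: the convex hull of a finite set of points. -/
def IsPolytope {V : Type*} [AddCommGroup V] [Module ℝ V] (P : Set V) : Prop :=
  ∃ S : Set V, S.Finite ∧ P = convexHull ℝ S

/-- A face of a convex set (the empty face and the improper face are allowed). -/
def IsFace {V : Type*} [AddCommGroup V] [Module ℝ V] (P F : Set V) : Prop :=
  Convex ℝ F ∧ IsExtreme ℝ P F

/-- The affine map `L` restricts to an isomorphism from the polytope `P` onto the polytope `Q`:
it is injective on the affine hull of `P`, maps `P` onto `Q`, and induces a bijection between the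
faces of `P` and the faces of `Q`. -/
structure IsPolytopeIso {V W : Type*} [AddCommGroup V] [Module ℝ V] [AddCommGroup W] [Module ℝ W]
    (L : V →ᵃ[ℝ] W) (P : Set V) (Q : Set W) : Prop where
  isPolytope_source : IsPolytope P
  isPolytope_target : IsPolytope Q
  injOn : Set.InjOn L (affineSpan ℝ P : Set V)
  image_eq : L '' P = Q
  face_iff : ∀ F : Set V, F ⊆ P → (IsFace P F ↔ IsFace Q (L '' F))

/-! ### Tight pairs and extremal functions -/

/-! The analytic core is that every extremal `f` takes only finitely many values modulo 1. On a
tight pair the values sum to an integer, so they are opposite on the circle, and each class `c ≠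
-c`, up to sign, contributes an independent direction to the tight subspace. The LRC bounds this
number for functions of `E'` near `f`, and by approximation for `f` itself
(`IsExtremal.finite_range_coe`). Hence positive slacks are bounded below, suprema are attained
(`IsExtremal.exists_tight`), and a cell is a compact convex set of finite dimension with
half-integral extreme points, so a polytope.

The rest is metric. If `{x, y}` is tight for `f`, then `g x + g y` is constant on the cell; by the
gate identity so is the sum of the distances from `g` to the gates of `x` and `y`, which are
therefore antipodal (`IsGate.dist_add_dist`). The map `Φ` is `g ↦ dist · g` on gates. It is onto
because an extremal function on an antipodal space is tight on antipodes, which returns exactly the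
equations of the cell. -/

theorem mk_mem_tightPairs {X : Type*} [MetricSpace X] {f : X → ℝ} {x y : X} :
    s(x, y) ∈ tightPairs f ↔ f x + f y = dist x y := by
  constructor
  · rintro ⟨a, b, hab, h⟩
    rcases Sym2.eq_iff.1 hab with ⟨rfl, rfl⟩ | ⟨rfl, rfl⟩
    · exact h
    · rw [add_comm, dist_comm, h]
  · exact fun h => ⟨x, y, rfl, h⟩

theorem isTightExtremal_of_exists {X : Type*} [MetricSpace X] {f : X → ℝ}
    (h : ∀ x y, dist x y ≤ f x + f y) (h' : ∀ x, ∃ y, f x + f y = dist x y) :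
    IsTightExtremal f :=
  ⟨h, fun x => (h' x).elim fun y hy =>
    ⟨s(x, y), mk_mem_tightPairs.2 hy, Sym2.mem_mk_left x y⟩⟩

theorem isExtremal_of_exists_tight {X : Type*} [MetricSpace X] {f : X → ℝ}
    (h : ∀ x y, dist x y ≤ f x + f y) (h' : ∀ x, ∃ y, f x + f y = dist x y) :
    IsExtremal f := by
  intro x
  constructor
  · rintro _ ⟨y, rfl⟩
    have := h x y
    simp only
    linarith
  · intro b hb
    obtain ⟨y, hy⟩ := h' x
    have := hb ⟨y, rfl⟩
    simp only at this
    linarith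

theorem mem_tightSubspace {X : Type*} [MetricSpace X] {f g : X → ℝ} :
    g ∈ tightSubspace (tightPairs f) ↔ ∀ x y, f x + f y = dist x y → g x + g y = dist x y :=
  ⟨fun h x y hxy => h x y (mk_mem_tightPairs.2 hxy),
    fun h x y hxy => h x y (mk_mem_tightPairs.1 hxy)⟩

/-! ### Approximation by functions with tight pairs -/

/-- A minimal admissible function works. Discreteness is essential: over `ℝ` a minimal function need
not attain its suprema, whereas over `ℕ` a point without tight partner can be lowered by a full
unit. -/
theorem exists_le_forall_exists_add_eq {X : Type*} (D : X → X → ℕ) (hD : ∀ x, D x x = 0)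
    (hsymm : ∀ x y, D x y = D y x) (G₀ : X → ℕ) (hG₀ : ∀ x y, D x y ≤ G₀ x + G₀ y) :
    ∃ G ≤ G₀, (∀ x y, D x y ≤ G x + G y) ∧ ∀ x, ∃ y, G x + G y = D x y := by
  classical
  obtain ⟨m, hm, hmax⟩ := zorn_le_nonempty₀ (α := (X → ℕ)ᵒᵈ)
    {G | ∀ x y, D x y ≤ (OrderDual.ofDual G) x + (OrderDual.ofDual G) y} (by
      intro c hc hchain G hG
      -- Infima in `ℕ` are attained, so the values of `I` at two points come from members of the
      -- chain, and the smaller member bounds both from below.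
      let I : X → ℕ := fun x => sInf ((fun F : (X → ℕ)ᵒᵈ => (OrderDual.ofDual F) x) '' c)
      have hI : ∀ x, ∃ F ∈ c, (OrderDual.ofDual F) x = I x := fun x =>
        Nat.sInf_mem (s := (fun F : (X → ℕ)ᵒᵈ => (OrderDual.ofDual F) x) '' c) ⟨_, G, hG, rfl⟩
      have hIle : ∀ F ∈ c, ∀ x, I x ≤ (OrderDual.ofDual F) x := fun F hF x =>
        Nat.sInf_le ⟨F, hF, rfl⟩
      refine ⟨OrderDual.toDual I, ?_, fun F hF x => hIle F hF x⟩
      intro x y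
      obtain ⟨F, hF, hFx⟩ := hI x
      obtain ⟨F', hF', hFy⟩ := hI y
      change D x y ≤ I x + I y
      rcases hchain.total hF hF' with h | h
      · have h1 := hc hF' x y
        have h2 : (OrderDual.ofDual F') x ≤ (OrderDual.ofDual F) x := h x
        omega
      · have h1 := hc hF x y
        have h2 : (OrderDual.ofDual F) y ≤ (OrderDual.ofDual F') y := h y
        omega)
    (OrderDual.toDual G₀) hG₀
  have hmem : ∀ x y, D x y ≤ (OrderDual.ofDual m) x + (OrderDual.ofDual m) y := hmax.prop
  refine ⟨OrderDual.ofDual m, hm, hmem, fun x => ?_⟩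
  by_contra! hne
  have hlt : ∀ y, D x y < (OrderDual.ofDual m) x + (OrderDual.ofDual m) y := fun y =>
    lt_of_le_of_ne (hmem x y) (hne y).symm
  have hpos : 0 < (OrderDual.ofDual m) x := by
    have := hlt x
    omega
  let F : X → ℕ := Function.update (OrderDual.ofDual m) x ((OrderDual.ofDual m) x - 1)
  have hF : ∀ a b, D a b ≤ F a + F b := by
    intro a b
    by_cases ha : a = x <;> by_cases hb : b = x
    · subst ha; subst hb; rw [hD]; exact Nat.zero_le _
    · subst ha
      simp only [F, Function.update_self, Function.update_of_ne hb]
      have := hlt b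
      omega
    · subst hb
      simp only [F, Function.update_self, Function.update_of_ne ha]
      have := hlt a
      rw [hsymm] at this
      omega
    · simp only [F, Function.update_of_ne hb, Function.update_of_ne ha]
      exact hmem a b
  have hle : m ≤ OrderDual.toDual F := by
    intro a
    change F a ≤ (OrderDual.ofDual m) a
    by_cases ha : a = x
    · subst ha; simp [F]
    · simp [F, Function.update_of_ne ha]
  have h := hmax.le_of_ge (y := OrderDual.toDual F) hF hle
  have h' : (OrderDual.ofDual m) x ≤ F x := h x
  simp only [F, Function.update_self] at h'
  omega

theorem IsExtremal.nonneg {X : Type*} [MetricSpace X] {f : X → ℝ} (hf : IsExtremal f) (x : X) :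
    0 ≤ f x := by
  have := hf.dist_le_add x x
  rw [dist_self] at this
  linarith

/-- Scale by `k + 1 > 1 / ε`, round up to naturals, pass to a minimal function below and scale back.
The upper bound comes from rounding; the lower one follows because extremality of `f` reverses
inequalities. -/
theorem IsExtremal.exists_isTightExtremal_near {X : Type*} [MetricSpace X]
    (hint : ∀ x y : X, ∃ n : ℤ, dist x y = n) {f : X → ℝ} (hf : IsExtremal f) {ε : ℝ}
    (hε : 0 < ε) : ∃ g : X → ℝ, IsTightExtremal g ∧ ∀ x, |f x - g x| ≤ ε := by
  obtain ⟨k, hk⟩ := exists_nat_one_div_lt hε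
  have hkpos : (0 : ℝ) < (k + 1 : ℕ) := by positivity
  have hnat : ∀ x y : X, ∃ n : ℕ, dist x y = n := by
    intro x y
    obtain ⟨n, hn⟩ := hint x y
    have : 0 ≤ n := by
      have := dist_nonneg (x := x) (y := y)
      rw [hn] at this
      exact_mod_cast this
    lift n to ℕ using this
    exact ⟨n, by simpa using hn⟩
  choose D hD using hnat
  obtain ⟨G, hG, hGD, hGt⟩ := exists_le_forall_exists_add_eq (fun x y => (k + 1) * D x y)
    (fun x => by
      have := hD x x
      rw [dist_self] at this
      have : D x x = 0 := by exact_mod_cast this.symm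
      simp [this])
    (fun x y => by
      have := hD x y
      rw [dist_comm, hD y x] at this
      have : D y x = D x y := by exact_mod_cast this
      simp [this])
    (fun x => ⌈((k + 1 : ℕ) : ℝ) * f x⌉₊)
    (fun x y => by
      have h1 := Nat.le_ceil (((k + 1 : ℕ) : ℝ) * f x)
      have h2 := Nat.le_ceil (((k + 1 : ℕ) : ℝ) * f y)
      have h3 := mul_le_mul_of_nonneg_left (hf.dist_le_add x y) hkpos.le
      rw [hD x y] at h3
      have : (((k + 1) * D x y : ℕ) : ℝ) ≤
          (⌈((k + 1 : ℕ) : ℝ) * f x⌉₊ + ⌈((k + 1 : ℕ) : ℝ) * f y⌉₊ : ℕ) := by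
        push_cast at *
        linarith
      exact_mod_cast this)
  let g : X → ℝ := fun x => G x / (k + 1 : ℕ)
  have hgd : ∀ x y, dist x y ≤ g x + g y := by
    intro x y
    have : (((k + 1) * D x y : ℕ) : ℝ) ≤ (G x + G y : ℕ) := by exact_mod_cast hGD x y
    simp only [g]
    rw [← add_div, le_div_iff₀ hkpos, hD]
    push_cast at *
    linarith
  have hgt : ∀ x, ∃ y, g x + g y = dist x y := by
    intro x
    obtain ⟨y, hy⟩ := hGt x
    refine ⟨y, ?_⟩
    have : ((G x + G y : ℕ) : ℝ) = ((k + 1) * D x y : ℕ) := by exact_mod_cast hy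
    simp only [g]
    rw [← add_div, div_eq_iff hkpos.ne', hD]
    push_cast at *
    linarith
  have hupper : ∀ x, g x ≤ f x + ε := by
    intro x
    have h1 : (G x : ℝ) ≤ ⌈((k + 1 : ℕ) : ℝ) * f x⌉₊ := by exact_mod_cast hG x
    have h2 := Nat.ceil_lt_add_one (mul_nonneg hkpos.le (hf.nonneg x))
    have h3 : 1 < ε * (k + 1 : ℕ) := by
      rw [div_lt_iff₀ (by positivity)] at hk
      push_cast
      exact hk
    simp only [g]
    rw [div_le_iff₀ hkpos]
    linarith
  refine ⟨g, isTightExtremal_of_exists hgd hgt, fun x => abs_le.2 ⟨by linarith [hupper x], ?_⟩⟩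
  have : f x ≤ g x + ε := by
    refine (hf x).2 ?_
    rintro _ ⟨y, rfl⟩
    have h1 := hgd x y
    have h2 := hupper y
    simp only
    linarith
  linarith

/-! ### Values modulo one -/

/-- The odd function on the circle equal to `1` at `c`, to `-1` at `-c` and zero elsewhere. -/
noncomputable def oddIndicator (c a : UnitAddCircle) : ℝ :=
  open Classical in (if a = c then 1 else 0) - (if a = -c then 1 else 0)

theorem oddIndicator_neg (c a : UnitAddCircle) : oddIndicator c (-a) = -oddIndicator c a := by
  simp only [oddIndicator, neg_neg, neg_eq_iff_eq_neg (a := a), neg_sub]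

theorem abs_oddIndicator_le (c a : UnitAddCircle) : |oddIndicator c a| ≤ 1 := by
  unfold oddIndicator
  split_ifs <;> simp

theorem oddIndicator_self {c : UnitAddCircle} (hc : c ≠ -c) : oddIndicator c c = 1 := by
  simp [oddIndicator, hc]

theorem oddIndicator_of_ne {c a : UnitAddCircle} (h : a ≠ c) (h' : a ≠ -c) :
    oddIndicator c a = 0 := by
  simp [oddIndicator, h, h']

theorem UnitAddCircle.coe_intCast (n : ℤ) : ((n : ℝ) : UnitAddCircle) = 0 :=
  (AddCircle.coe_eq_zero_iff 1).2 ⟨n, by simp⟩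

theorem UnitAddCircle.coe_eq_neg_of_add_eq_int {a b : ℝ} {n : ℤ} (h : a + b = n) :
    (b : UnitAddCircle) = -(a : UnitAddCircle) := by
  rw [eq_neg_iff_add_eq_zero, add_comm, ← AddCircle.coe_add, h, UnitAddCircle.coe_intCast]

theorem oddIndicator_add_eq_zero {c : UnitAddCircle} {a b : ℝ} {n : ℤ} (h : a + b = n) :
    oddIndicator c a + oddIndicator c b = 0 := by
  rw [UnitAddCircle.coe_eq_neg_of_add_eq_int h, oddIndicator_neg, add_neg_cancel]

/-- An odd function of the values modulo 1 cancels on every tight pair, since integrality of the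
metric makes those values opposite. -/
theorem oddIndicator_mem_direction {X : Type*} [MetricSpace X]
    (hint : ∀ x y : X, ∃ n : ℤ, dist x y = n) (g : X → ℝ) (c : UnitAddCircle) :
    (fun x => oddIndicator c (g x)) ∈ (tightSubspace (tightPairs g)).direction := by
  have h1 : g ∈ tightSubspace (tightPairs g) := mem_tightSubspace.2 fun _ _ h => h
  have h2 : (fun x => oddIndicator c (g x)) + g ∈ tightSubspace (tightPairs g) := by
    refine mem_tightSubspace.2 fun x y h => ?_
    obtain ⟨n, hn⟩ := hint x y
    have := oddIndicator_add_eq_zero (c := c) (h.trans hn)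
    simp only [Pi.add_apply]
    linarith
  have := AffineSubspace.vsub_mem_direction h2 h1
  simpa using this

/-- The odd indicators of the classes at the chosen points form the identity matrix when evaluated
at these points, so they are independent. -/
theorem card_le_of_tightRank_le {X : Type*} [MetricSpace X]
    (hint : ∀ x y : X, ∃ n : ℤ, dist x y = n) {g : X → ℝ} {N m : ℕ}
    (hN : tightRank (tightPairs g) ≤ N) (x : Fin m → X)
    (hx : ∀ i, (g (x i) : UnitAddCircle) ≠ -(g (x i) : UnitAddCircle))
    (hne : ∀ i j, i ≠ j → (g (x i) : UnitAddCircle) ≠ g (x j) ∧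
      (g (x i) : UnitAddCircle) ≠ -(g (x j) : UnitAddCircle)) : m ≤ N := by
  let v : Fin m → (tightSubspace (tightPairs g)).direction := fun i =>
    ⟨fun y => oddIndicator (g (x i)) (g y), oddIndicator_mem_direction hint g _⟩
  have hv : LinearIndependent ℝ v := by
    rw [Fintype.linearIndependent_iff]
    intro a ha i
    have h := congrFun (congrArg Subtype.val ha) (x i)
    simp only [v, Submodule.coe_sum, Submodule.coe_smul, Finset.sum_apply, Pi.smul_apply,
      smul_eq_mul, Submodule.coe_zero, Pi.zero_apply] at h
    rw [Finset.sum_eq_single i] at h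
    · simpa [oddIndicator_self (hx i)] using h
    · intro j _ hji
      rw [oddIndicator_of_ne (hne i j hji.symm).1 (hne i j hji.symm).2, mul_zero]
    · simp
  have h := hv.cardinal_lift_le_rank
  have hN' : Module.rank ℝ (tightSubspace (tightPairs g)).direction ≤ N := by
    rwa [tightRank, Cardinal.toENat_le_natCast] at hN
  have h2 := h.trans (Cardinal.lift_le.2 hN')
  simpa using h2

section ValuesModOne

open Filter Topology

theorem supDist_le {X : Type*} {f g : X → ℝ} {ε : ℝ} (hε : 0 ≤ ε) (h : ∀ x, |f x - g x| ≤ ε) :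
    supDist f g ≤ ε :=
  Real.iSup_le h hε

theorem UnitAddCircle.finite_setOf_eq_neg : {c : UnitAddCircle | c = -c}.Finite := by
  convert AddCircle.finite_torsion (1 : ℝ) (n := 2) two_pos using 3 with c
  rw [two_nsmul, eq_neg_iff_add_eq_zero]

/-- Under the local rank condition an extremal function takes finitely many values modulo `1`. -/
theorem IsExtremal.finite_range_coe {X : Type*} [MetricSpace X]
    (hint : ∀ x y : X, ∃ n : ℤ, dist x y = n) (hLRC : LocalRankCondition X) {f : X → ℝ}
    (hf : IsExtremal f) : (Set.range fun x => (f x : UnitAddCircle)).Finite := by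
  obtain ⟨ε, hε, N, hN⟩ := hLRC f hf
  by_contra hinf
  -- Greedy choice: each new value avoids the finitely many 2-torsion classes and the earlier values
  -- up to sign.
  obtain ⟨x, hx, hxx⟩ := exists_seq_of_forall_finset_exists
    (fun x : X => (f x : UnitAddCircle) ≠ -(f x : UnitAddCircle))
    (fun x y : X => (f x : UnitAddCircle) ≠ f y ∧ (f x : UnitAddCircle) ≠ -(f y : UnitAddCircle))
    (by
      intro s _
      have hfin : ({c : UnitAddCircle | c = -c} ∪
          ((fun x => (f x : UnitAddCircle)) '' s ∪ (fun x => -(f x : UnitAddCircle)) '' s)).Finite :=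
        UnitAddCircle.finite_setOf_eq_neg.union
          ((s.finite_toSet.image _).union (s.finite_toSet.image _))
      obtain ⟨_, ⟨y, rfl⟩, hy⟩ := (Set.Infinite.sdiff hinf hfin).nonempty
      refine ⟨y, fun h => hy (Or.inl h), fun z hz => ⟨fun h => ?_, fun h => ?_⟩⟩
      · exact hy (Or.inr (Or.inl ⟨z, hz, h⟩))
      · exact hy (Or.inr (Or.inr ⟨z, hz, by simp [h]⟩)))
  choose g hg hgf using fun k : ℕ =>
    hf.exists_isTightExtremal_near hint (ε := 1 / ((k : ℝ) + 1)) (by positivity)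
  have hlim0 : Tendsto (fun k : ℕ => 1 / ((k : ℝ) + 1)) atTop (𝓝 0) :=
    tendsto_one_div_add_atTop_nhds_zero_nat
  have hlim : ∀ y, Tendsto (fun k => (g k y : UnitAddCircle)) atTop (𝓝 (f y : UnitAddCircle)) := by
    intro y
    refine ((AddCircle.continuous_mk' (1 : ℝ)).tendsto (f y)).comp ?_
    rw [tendsto_iff_dist_tendsto_zero]
    refine squeeze_zero (fun _ => dist_nonneg) (fun k => ?_) hlim0
    rw [dist_comm]
    exact hgf k y
  -- Being distinct is an open condition, so the finitely many inequalities among `N + 1` points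
  -- pass from `f` to a close approximant, contradicting rank at most `N`.
  have hlimne : ∀ {u v : ℕ → UnitAddCircle} {a b : UnitAddCircle}, Tendsto u atTop (𝓝 a) →
      Tendsto v atTop (𝓝 b) → a ≠ b → ∀ᶠ k in atTop, u k ≠ v k := fun hu hv hab =>
    ((hu.sub hv).eventually_ne (sub_ne_zero.2 hab)).mono fun _ => sub_ne_zero.1
  have hev1 : ∀ i : Fin (N + 1), ∀ᶠ k in atTop,
      (g k (x i) : UnitAddCircle) ≠ -(g k (x i) : UnitAddCircle) := fun i =>
    hlimne (hlim (x i)) (hlim (x i)).neg (hx i)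
  have hev2 : ∀ i j : Fin (N + 1), i ≠ j → ∀ᶠ k in atTop,
      (g k (x i) : UnitAddCircle) ≠ g k (x j) ∧
      (g k (x i) : UnitAddCircle) ≠ -(g k (x j) : UnitAddCircle) := by
    intro i j hij
    have key : (f (x i) : UnitAddCircle) ≠ f (x j) ∧
        (f (x i) : UnitAddCircle) ≠ -(f (x j) : UnitAddCircle) := by
      rcases lt_or_gt_of_ne hij with h | h
      · exact hxx i j h
      · obtain ⟨h1, h2⟩ := hxx j i h
        exact ⟨h1.symm, fun h => h2 (by simp [h])⟩
    exact (hlimne (hlim (x i)) (hlim (x j)) key.1).and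
      (hlimne (hlim (x i)) (hlim (x j)).neg key.2)
  have hev3 : ∀ᶠ k : ℕ in atTop, 1 / ((k : ℝ) + 1) < ε := hlim0.eventually_lt_const hε
  obtain ⟨k, hk1, hk2, hk3⟩ := ((eventually_all.2 hev1).and
    ((eventually_all.2 fun i => eventually_all.2 fun j => eventually_all.2 (hev2 i j)).and
      hev3)).exists
  have hrank := hN (g k) (hg k) ((supDist_le (by positivity) (hgf k)).trans_lt hk3)
  have := card_le_of_tightRank_le hint hrank (fun i : Fin (N + 1) => x i) hk1 hk2
  omega

/-- If `f` takes finitely many values modulo `1`, the positive slacks of the inequalities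
`d(x,y) ≤ f x + f y` are bounded away from zero. -/
theorem exists_pos_le_slack {X : Type*} [MetricSpace X]
    (hint : ∀ x y : X, ∃ n : ℤ, dist x y = n) {f : X → ℝ}
    (hfin : (Set.range fun x => (f x : UnitAddCircle)).Finite) :
    ∃ δ : ℝ, 0 < δ ∧ ∀ x y, dist x y < f x + f y → dist x y + δ ≤ f x + f y := by
  -- Positive reals in one class modulo 1 are at least its representative in `(0, 1]`; slacks meet
  -- only the finitely many classes in the sumset of the values of `f`.
  have hclass : ∀ c : UnitAddCircle, ∀ᶠ δ : ℝ in 𝓝[>] 0,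
      ∀ s : ℝ, 0 < s → (s : UnitAddCircle) = c → δ ≤ s := by
    intro c
    by_cases hc : ∃ s : ℝ, 0 < s ∧ s ≤ 1 ∧ (s : UnitAddCircle) = c
    · obtain ⟨s, hs, hs1, rfl⟩ := hc
      filter_upwards [Ioc_mem_nhdsGT hs] with δ hδ t ht hts
      refine hδ.2.trans ?_
      obtain ⟨n, hn⟩ := (AddCircle.coe_eq_zero_iff (1 : ℝ)).1
        (show ((t - s : ℝ) : UnitAddCircle) = 0 by rw [AddCircle.coe_sub, hts, sub_self])
      rw [zsmul_one] at hn
      have : (-1 : ℝ) < n := by linarith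
      have : (-1 : ℤ) < n := by exact_mod_cast this
      have : (0 : ℝ) ≤ n := by exact_mod_cast (by omega : 0 ≤ n)
      linarith
    · filter_upwards [Ioc_mem_nhdsGT one_pos] with δ hδ t ht hts
      by_contra! h
      exact hc ⟨t, ht, (h.le.trans hδ.2), hts⟩
  have hall := (eventually_all_finite (hfin.add hfin)).2 fun c _ => hclass c
  obtain ⟨δ, hδ, hδ0⟩ := (hall.and self_mem_nhdsWithin).exists
  refine ⟨δ, hδ0, fun x y hxy => ?_⟩
  have := hδ _ (Set.add_mem_add ⟨x, rfl⟩ ⟨y, rfl⟩) (f x + f y - dist x y) (by linarith) (by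
    obtain ⟨n, hn⟩ := hint x y
    rw [AddCircle.coe_sub, hn, UnitAddCircle.coe_intCast, sub_zero, AddCircle.coe_add])
  linarith

theorem IsExtremal.exists_tight {X : Type*} [MetricSpace X]
    (hint : ∀ x y : X, ∃ n : ℤ, dist x y = n) (hLRC : LocalRankCondition X) {f : X → ℝ}
    (hf : IsExtremal f) (x : X) : ∃ y, f x + f y = dist x y := by
  obtain ⟨δ, hδ, h⟩ := exists_pos_le_slack hint (hf.finite_range_coe hint hLRC)
  by_contra! hne
  have : f x ≤ f x - δ := by
    refine (hf x).2 ?_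
    rintro _ ⟨y, rfl⟩
    have := h x y (lt_of_le_of_ne (hf.dist_le_add x y) (hne y).symm)
    simp only
    linarith
  linarith

end ValuesModOne

/-! ### Cells are polytopes -/

/-- The tight partners of `f` remain tight throughout the cell, so extremality reduces to closed
linear conditions. -/
theorem image_val_cell {X : Type*} [MetricSpace X] {f : InjHull X}
    (hf : ∀ x, ∃ y, f.1 x + f.1 y = dist x y) :
    Subtype.val '' cell f = {g : X → ℝ | (∀ x y, dist x y ≤ g x + g y) ∧
      ∀ x y, f.1 x + f.1 y = dist x y → g x + g y = dist x y} := by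
  ext g
  constructor
  · rintro ⟨g, hg, rfl⟩
    exact ⟨fun x y => g.2.dist_le_add x y, mem_tightSubspace.1 hg⟩
  · rintro ⟨h1, h2⟩
    exact ⟨⟨g, isExtremal_of_exists_tight h1 fun x =>
      (hf x).imp fun y hy => h2 x y hy⟩, mem_tightSubspace.2 h2, rfl⟩

theorem convex_image_val_cell {X : Type*} [MetricSpace X] {f : InjHull X}
    (hf : ∀ x, ∃ y, f.1 x + f.1 y = dist x y) : Convex ℝ (Subtype.val '' cell f) := by
  rw [image_val_cell hf]
  intro g hg h hh a b ha hb hab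
  refine ⟨fun x y => ?_, fun x y hxy => ?_⟩
  · have h1 := mul_le_mul_of_nonneg_left (hg.1 x y) ha
    have h2 := mul_le_mul_of_nonneg_left (hh.1 x y) hb
    have h3 : dist x y = a * dist x y + b * dist x y := by rw [← add_mul, hab, one_mul]
    simp only [Pi.add_apply, Pi.smul_apply, smul_eq_mul]
    linarith
  · have h1 := hg.2 x y hxy
    have h2 := hh.2 x y hxy
    simp only [Pi.add_apply, Pi.smul_apply, smul_eq_mul]
    linear_combination a * h1 + b * h2 + dist x y * hab

theorem isCompact_image_val_cell {X : Type*} [MetricSpace X] {f : InjHull X}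
    (hf : ∀ x, ∃ y, f.1 x + f.1 y = dist x y) : IsCompact (Subtype.val '' cell f) := by
  choose y hy using hf
  refine (isCompact_univ_pi fun x => isCompact_Icc (a := (0 : ℝ)) (b := dist x (y x))).of_isClosed_subset
    ?_ ?_
  · rw [image_val_cell fun x => ⟨y x, hy x⟩]
    simp only [Set.ofPred_and, Set.ofPred_forall]
    refine IsClosed.inter ?_ ?_
    · exact isClosed_iInter fun x => isClosed_iInter fun z =>
        isClosed_le continuous_const ((continuous_apply x).add (continuous_apply z))
    · exact isClosed_iInter fun x => isClosed_iInter fun z => isClosed_iInter fun _ =>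
        isClosed_eq ((continuous_apply x).add (continuous_apply z)) continuous_const
  · rintro _ ⟨g, hg, rfl⟩ x -
    have h1 := mem_tightSubspace.1 hg x (y x) (hy x)
    have h2 := g.2.nonneg x
    have h3 := g.2.nonneg (y x)
    exact ⟨h2, by linarith⟩

/-- If `h x` were not a half-integer, `h` could move both ways along the odd indicator of its class
without leaving the cell. -/
theorem coe_eq_neg_of_mem_extremePoints {X : Type*} [MetricSpace X]
    (hint : ∀ x y : X, ∃ n : ℤ, dist x y = n) (hLRC : LocalRankCondition X) {f : InjHull X}
    {h : X → ℝ} (hh : h ∈ (Subtype.val '' cell f).extremePoints ℝ) (x : X) :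
    (h x : UnitAddCircle) = -(h x : UnitAddCircle) := by
  have hf := f.2.exists_tight hint hLRC
  obtain ⟨hmem, hext⟩ := mem_extremePoints.1 hh
  have hhE : IsExtremal h := by
    obtain ⟨g, -, rfl⟩ := hmem
    exact g.2
  by_contra hne
  obtain ⟨δ, hδ, hslack⟩ := exists_pos_le_slack hint (hhE.finite_range_coe hint hLRC)
  rw [image_val_cell hf] at hext hmem
  let p : X → ℝ := fun y => oddIndicator (h x) (h y)
  -- Tight sums do not change; other sums have slack at least `δ` and lose at most `δ / 2` at each
  -- of the two points.
  have hp : ∀ t : ℝ, |t| ≤ δ / 2 → h + t • p ∈ {g : X → ℝ | (∀ x y, dist x y ≤ g x + g y) ∧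
      ∀ x y, f.1 x + f.1 y = dist x y → g x + g y = dist x y} := by
    intro t ht
    have hz : ∀ a b, h a + h b = dist a b → p a + p b = 0 := fun a b hab => by
      obtain ⟨n, hn⟩ := hint a b
      exact oddIndicator_add_eq_zero (hab.trans hn)
    refine ⟨fun a b => ?_, fun a b hab => ?_⟩
    · simp only [Pi.add_apply, Pi.smul_apply, smul_eq_mul]
      rcases (hmem.1 a b).lt_or_eq with hlt | heq
      · have h1 := hslack a b hlt
        have hb : ∀ y, -(δ / 2) ≤ t * p y := fun y => by
          have h2 : |t * p y| ≤ δ / 2 * 1 := by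
            rw [abs_mul]
            exact mul_le_mul ht (abs_oddIndicator_le _ _) (abs_nonneg _) (by positivity)
          linarith [neg_abs_le (t * p y)]
        linarith [hb a, hb b]
      · linear_combination heq.le - t * hz a b heq.symm
    · have h1 := hmem.2 a b hab
      simp only [Pi.add_apply, Pi.smul_apply, smul_eq_mul]
      linear_combination h1 + t * hz a b h1
  have hseg : h ∈ openSegment ℝ (h + (δ / 2) • p) (h + (-(δ / 2)) • p) := by
    refine ⟨1 / 2, 1 / 2, by norm_num, by norm_num, by norm_num, ?_⟩
    module
  have h1 := (hext _ (hp _ (by rw [abs_of_pos (by positivity)]))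
    _ (hp _ (by rw [abs_neg, abs_of_pos (by positivity)])) hseg).1
  have h2 := congrFun h1 x
  simp only [Pi.add_apply, Pi.smul_apply, smul_eq_mul, p, oddIndicator_self hne] at h2
  linarith

/-- The evaluation kernels have zero intersection, and in finite dimension finitely many of them
suffice. -/
theorem exists_finset_separating {X : Type*} (W : Submodule ℝ (X → ℝ)) [Module.Finite ℝ W] :
    ∃ s : Finset X, ∀ w ∈ W, (∀ x ∈ s, w x = 0) → w = 0 := by
  obtain ⟨s, hs⟩ := Finset.exists_inf_le fun x : X =>
    LinearMap.ker ((LinearMap.proj x : (X → ℝ) →ₗ[ℝ] ℝ).comp W.subtype)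
  refine ⟨s, fun w hw h => funext fun x => ?_⟩
  have hm : (⟨w, hw⟩ : W) ∈ s.inf fun x : X =>
      LinearMap.ker ((LinearMap.proj x : (X → ℝ) →ₗ[ℝ] ℝ).comp W.subtype) := by
    rw [Submodule.mem_finsetInf]
    exact fun y hy => h y hy
  exact hs x hm

theorem finite_extremePoints_cell {X : Type*} [MetricSpace X]
    (hint : ∀ x y : X, ∃ n : ℤ, dist x y = n) (hLRC : LocalRankCondition X) (f : InjHull X) :
    ((Subtype.val '' cell f).extremePoints ℝ).Finite := by
  have hf := f.2.exists_tight hint hLRC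
  have : Module.Finite ℝ (tightSubspace (tightPairs f.1)).direction := by
    obtain ⟨ε, hε, N, hN⟩ := hLRC f.1 f.2
    have h := hN f.1 (isTightExtremal_of_exists f.2.dist_le_add hf)
      ((supDist_le le_rfl fun x => by simp).trans_lt hε)
    rw [tightRank, Cardinal.toENat_le_natCast] at h
    exact Module.rank_lt_aleph0_iff.1 (h.trans_lt Cardinal.natCast_lt_aleph0)
  obtain ⟨s, hs⟩ := exists_finset_separating (tightSubspace (tightPairs f.1)).direction
  choose y hy using hf
  have hfin : ∀ x, {r : ℝ | r ∈ Set.Icc 0 (dist x (y x)) ∧ ∃ n : ℤ, r = n / 2}.Finite := by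
    intro x
    refine ((Set.finite_Icc (0 : ℤ) ⌊2 * dist x (y x)⌋).image fun n : ℤ => (n : ℝ) / 2).subset ?_
    rintro _ ⟨⟨h1, h2⟩, n, rfl⟩
    refine ⟨n, ⟨?_, Int.le_floor.2 (by linarith)⟩, rfl⟩
    have : (0 : ℝ) ≤ n := by linarith
    exact_mod_cast this
  -- Extreme points are determined by their coordinates in `s`, each a half-integer in a bounded
  -- interval.
  refine Set.Finite.of_finite_image (f := fun (h : X → ℝ) (x : s) => h x) ?_ ?_
  · refine (Set.Finite.pi fun x : s => hfin x).subset ?_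
    rintro _ ⟨h, hh, rfl⟩ x -
    refine ⟨?_, ?_⟩
    · obtain ⟨g, hg, rfl⟩ := hh.1
      have h1 := mem_tightSubspace.1 hg x (y x) (hy x)
      exact ⟨g.2.nonneg x, by linarith [g.2.nonneg (y x)]⟩
    · have h1 := coe_eq_neg_of_mem_extremePoints hint hLRC hh x
      rw [eq_neg_iff_add_eq_zero, ← AddCircle.coe_add] at h1
      obtain ⟨n, hn⟩ := (AddCircle.coe_eq_zero_iff (1 : ℝ)).1 h1
      rw [zsmul_one] at hn
      exact ⟨n, by linarith⟩
  · intro g hg h hh hgh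
    obtain ⟨g, hg', rfl⟩ := hg.1
    obtain ⟨h, hh', rfl⟩ := hh.1
    refine sub_eq_zero.1 (hs _ (AffineSubspace.vsub_mem_direction hg' hh') fun x hx => ?_)
    have := congrFun hgh ⟨x, hx⟩
    simp only at this
    simp [this]

/-- Krein–Milman; the closure is superfluous because the hull of finitely many points is closed. -/
theorem isPolytope_image_val_cell {X : Type*} [MetricSpace X]
    (hint : ∀ x y : X, ∃ n : ℤ, dist x y = n) (hLRC : LocalRankCondition X) (f : InjHull X) :
    IsPolytope (Subtype.val '' cell f) := by
  have hf := f.2.exists_tight hint hLRC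
  have hfin := finite_extremePoints_cell hint hLRC f
  refine ⟨_, hfin, ?_⟩
  rw [← (hfin.isClosed_convexHull ℝ).closure_eq]
  exact (closure_convexHull_extremePoints (isCompact_image_val_cell hf)
    (convex_image_val_cell hf)).symm

/-! ### Gates of a cell -/

theorem InjHull.abs_sub_le_dist {X : Type*} [MetricSpace X] (g h : InjHull X) (x : X) :
    |g.1 x - h.1 x| ≤ dist g h :=
  le_ciSup (g.2.bddAbove_abs_sub h.2) x

theorem InjHull.dist_le {X : Type*} [MetricSpace X] {g h : InjHull X} {r : ℝ} (hr : 0 ≤ r)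
    (H : ∀ x, |g.1 x - h.1 x| ≤ r) : dist g h ≤ r :=
  supDist_le hr H

theorem InjHull.dist_embed {X : Type*} [MetricSpace X] (x : X) (g : InjHull X) :
    dist (InjHull.embed x) g = g.1 x := by
  refine le_antisymm (InjHull.dist_le (g.2.nonneg x) fun y => ?_) ?_
  · have h1 := g.2.dist_le_add x y
    have h2 := g.2.le_add_dist y x
    rw [dist_comm] at h2
    simp only [InjHull.embed]
    exact abs_le.2 ⟨by linarith, by linarith⟩
  · have h := InjHull.abs_sub_le_dist (InjHull.embed x) g x
    simp only [InjHull.embed, dist_self, zero_sub, abs_neg] at h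
    exact (le_abs_self _).trans h

section Gates

variable {X : Type*} [MetricSpace X] {f : InjHull X}

theorem IsGate.apply_eq {x : X} {γ g : InjHull X} (h : IsGate InjHull.embed (cell f) x γ)
    (hg : g ∈ cell f) : g.1 x = γ.1 x + dist γ g := by
  have := h.2 g hg
  rwa [InjHull.dist_embed, InjHull.dist_embed] at this

theorem IsGate.unique {x : X} {γ γ' : InjHull X} (h : IsGate InjHull.embed (cell f) x γ)
    (h' : IsGate InjHull.embed (cell f) x γ') : γ = γ' := by
  have h1 := h.apply_eq h'.1
  have h2 := h'.apply_eq h.1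
  rw [dist_comm] at h2
  exact dist_eq_zero.1 (by linarith)

theorem mem_gates {x : X} {γ : InjHull X} (h : IsGate InjHull.embed (cell f) x γ) :
    γ ∈ gates (InjHull.embed : X → InjHull X) (cell f) :=
  ⟨x, h⟩

/-- The gates of the two points of a tight pair are antipodal in the cell. -/
theorem IsGate.dist_add_dist {x y : X} (hxy : f.1 x + f.1 y = dist x y) {γ γ' g : InjHull X}
    (h : IsGate InjHull.embed (cell f) x γ) (h' : IsGate InjHull.embed (cell f) y γ')
    (hg : g ∈ cell f) : dist γ γ' = dist γ g + dist g γ' := by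
  have h1 := h.apply_eq hg
  have h2 := h'.apply_eq hg
  have h3 := h.apply_eq h'.1
  have h4 := mem_tightSubspace.1 hg x y hxy
  have h5 := mem_tightSubspace.1 h'.1 x y hxy
  rw [dist_comm γ' g] at h2
  linarith

theorem eq_of_antipodal {Y : Type*} [MetricSpace Y] {p q q' : Y}
    (h : dist p q = dist p q' + dist q' q) (h' : dist p q' = dist p q + dist q q') : q = q' := by
  rw [dist_comm q' q] at h
  exact dist_eq_zero.1 (by linarith)

/-- The antipode is the gate of a tight partner. Betweenness is recorded for all of the cell, as
`distToGates` needs it beyond the gates. -/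
theorem exists_antipode (hf : ∀ x, ∃ y, f.1 x + f.1 y = dist x y)
    (hgated : IsGated (InjHull.embed : X → InjHull X) (cell f))
    (γ : gates (InjHull.embed : X → InjHull X) (cell f)) :
    ∃ γ' : gates (InjHull.embed : X → InjHull X) (cell f),
      ∀ g ∈ cell f, dist γ.1 γ'.1 = dist γ.1 g + dist g γ'.1 := by
  obtain ⟨γ, x, hx⟩ := γ
  obtain ⟨y, hxy⟩ := hf x
  obtain ⟨γ', hy⟩ := hgated y
  exact ⟨⟨γ', mem_gates hy⟩, fun g hg => hx.dist_add_dist hxy hy hg⟩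

theorem isAntipodal_gates (hf : ∀ x, ∃ y, f.1 x + f.1 y = dist x y)
    (hgated : IsGated (InjHull.embed : X → InjHull X) (cell f)) :
    IsAntipodal (gates (InjHull.embed : X → InjHull X) (cell f)) := by
  choose σ hσ using exists_antipode hf hgated
  have hcell : ∀ γ : gates (InjHull.embed : X → InjHull X) (cell f), γ.1 ∈ cell f :=
    fun γ => γ.2.elim fun x hx => hx.1
  -- Antipodes are unique by `eq_of_antipodal`, so any choice of them is an involution.
  refine ⟨σ, fun γ => ?_, fun γ γ' => hσ γ γ'.1 (hcell γ')⟩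
  have h1 := hσ (σ γ) γ.1 (hcell γ)
  have h2 := hσ γ (σ (σ γ)).1 (hcell _)
  refine Subtype.ext (eq_of_antipodal (p := (σ γ).1) h1 ?_)
  rw [dist_comm (σ γ).1 γ.1, h2, dist_comm γ.1, dist_comm (σ γ).1, add_comm]

end Gates

/-- On an antipodal space, an extremal function is tight on every pair of antipodes. -/
theorem IsExtremal.add_eq_dist_of_antipodal {Y : Type*} [MetricSpace Y] {φ : Y → ℝ}
    (hφ : IsExtremal φ) {p q : Y} (h : ∀ r, dist p q = dist p r + dist r q) :
    φ p + φ q = dist p q := by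
  refine le_antisymm ?_ (hφ.dist_le_add p q)
  have : φ p ≤ dist p q - φ q := by
    refine (hφ p).2 ?_
    rintro _ ⟨r, rfl⟩
    have h1 := h r
    have h2 := hφ.le_add_dist q r
    rw [dist_comm q r] at h2
    simp only
    linarith
  linarith

/-! ### Faces under affine maps -/

theorem isFace_image_iff {V W : Type*} [AddCommGroup V] [Module ℝ V] [AddCommGroup W] [Module ℝ W]
    (L : V →ᵃ[ℝ] W) {P F : Set V} (hP : Convex ℝ P) (hL : Set.InjOn L P) (hF : F ⊆ P) :
    IsFace P F ↔ IsFace (L '' P) (L '' F) := by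
  constructor
  · rintro ⟨hc, he⟩
    refine ⟨hc.affine_image L, Set.image_mono hF, ?_⟩
    rintro _ ⟨x, hx, rfl⟩ _ ⟨y, hy, rfl⟩ _ ⟨z, hz, rfl⟩ hseg
    rw [← image_openSegment] at hseg
    obtain ⟨w, hw, hwz⟩ := hseg
    have : w = z := hL (hP.openSegment_subset hx hy hw) (hF hz) hwz
    subst this
    exact ⟨x, he.2 hx hy hz hw, rfl⟩
  · rintro ⟨hc, he⟩
    refine ⟨?_, hF, ?_⟩
    · rw [convex_iff_segment_subset]
      intro x hx y hy z hz
      have h1 : L z ∈ L '' F := by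
        refine hc.segment_subset ⟨x, hx, rfl⟩ ⟨y, hy, rfl⟩ ?_
        rw [← image_segment]
        exact ⟨z, hz, rfl⟩
      obtain ⟨w, hw, hwz⟩ := h1
      have : w = z := hL (hF hw) (hP.segment_subset (hF hx) (hF hy) hz) hwz
      exact this ▸ hw
    · intro x hx y hy z hz hseg
      obtain ⟨w, hw, hwx⟩ := he.2 ⟨x, hx, rfl⟩ ⟨y, hy, rfl⟩ ⟨z, hz, rfl⟩ (by
        rw [← image_openSegment]
        exact ⟨z, hseg, rfl⟩)
      exact hL (hF hw) hx hwx ▸ hw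

theorem IsPolytope.affine_image {V W : Type*} [AddCommGroup V] [Module ℝ V] [AddCommGroup W]
    [Module ℝ W] {P : Set V} (hP : IsPolytope P) (L : V →ᵃ[ℝ] W) : IsPolytope (L '' P) := by
  obtain ⟨S, hS, rfl⟩ := hP
  exact ⟨L '' S, hS.image L, L.image_convexHull S⟩

theorem eqOn_affineSpan {V W : Type*} [AddCommGroup V] [Module ℝ V] [AddCommGroup W]
    [Module ℝ W] {L M : V →ᵃ[ℝ] W} {P : Set V} (h : Set.EqOn L M P) :
    Set.EqOn L M (affineSpan ℝ P : Set V) := by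
  intro v hv
  refine affineSpan_induction (p := fun v => L v = M v) hv (fun x hx => h hx) ?_
  intro c u v w hu hv hw
  simp only [AffineMap.map_vadd, LinearMap.map_smul, AffineMap.linearMap_vsub, hu, hv, hw]

/-! ### The isometry between a gated cell and the hull of its gates -/

section Isometry

variable {X : Type*} [MetricSpace X] {f : InjHull X}

/-- The function `γ ↦ d_∞(g, γ)` on the gates of a cell, for `g` in the cell. -/
noncomputable def distToGates (hf : ∀ x, ∃ y, f.1 x + f.1 y = dist x y)
    (hgated : IsGated (InjHull.embed : X → InjHull X) (cell f)) (g : cell f) :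
    InjHull (gates (InjHull.embed : X → InjHull X) (cell f)) :=
  ⟨fun γ => dist γ.1 g.1, isExtremal_of_exists_tight
    (fun γ γ' => by
      rw [dist_comm γ'.1]
      exact dist_triangle γ.1 g.1 γ'.1)
    (fun γ => (exists_antipode hf hgated γ).imp fun γ' h => by
      rw [dist_comm γ'.1]
      exact (h g.1 g.2).symm)⟩

/-- This shows that `g x - γ x` does not depend on which `x` with gate `γ` is used. -/
theorem distToGates_apply (hf : ∀ x, ∃ y, f.1 x + f.1 y = dist x y)
    (hgated : IsGated (InjHull.embed : X → InjHull X) (cell f)) (g : cell f) {x : X}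
    {γ : gates (InjHull.embed : X → InjHull X) (cell f)}
    (h : IsGate InjHull.embed (cell f) x γ.1) :
    (distToGates hf hgated g).1 γ = g.1.1 x - γ.1.1 x := by
  rw [h.apply_eq g.2, add_sub_cancel_left]
  rfl

/-- The shift by `γ x` cancels in differences, and since gates and points of `X` cover each other,
both suprema run over the same numbers. -/
theorem isometry_distToGates (hf : ∀ x, ∃ y, f.1 x + f.1 y = dist x y)
    (hgated : IsGated (InjHull.embed : X → InjHull X) (cell f)) :
    Isometry (distToGates hf hgated) := by
  refine Isometry.of_dist_eq fun g h => le_antisymm ?_ ?_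
  · refine InjHull.dist_le dist_nonneg fun γ => ?_
    obtain ⟨x, hx⟩ := γ.2
    rw [distToGates_apply hf hgated g hx, distToGates_apply hf hgated h hx, sub_sub_sub_cancel_right]
    exact InjHull.abs_sub_le_dist g.1 h.1 x
  · refine InjHull.dist_le dist_nonneg fun x => ?_
    obtain ⟨γ, hx⟩ := hgated x
    have := InjHull.abs_sub_le_dist (distToGates hf hgated g) (distToGates hf hgated h)
      ⟨γ, mem_gates hx⟩
    rwa [distToGates_apply hf hgated g hx, distToGates_apply hf hgated h hx,
      sub_sub_sub_cancel_right] at this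

theorem surjective_distToGates (hf : ∀ x, ∃ y, f.1 x + f.1 y = dist x y)
    (hgated : IsGated (InjHull.embed : X → InjHull X) (cell f)) :
    Function.Surjective (distToGates hf hgated) := by
  intro φ
  choose γ hγ using fun x => hgated x
  let G : X → gates (InjHull.embed : X → InjHull X) (cell f) := fun x => ⟨γ x, mem_gates (hγ x)⟩
  -- The only candidate, obtained by solving the formula for `Φ`.
  let g : X → ℝ := fun x => φ.1 (G x) + (γ x).1 x
  have hcell : ∀ q : gates (InjHull.embed : X → InjHull X) (cell f), q.1 ∈ cell f :=
    fun q => q.2.elim fun x hx => hx.1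
  have hg : g ∈ Subtype.val '' cell f := by
    rw [image_val_cell hf]
    refine ⟨fun x y => ?_, fun x y hxy => ?_⟩
    -- The gate identity turns `dist (γ x) (γ y)` into a difference of values at `x`, reducing the
    -- claim to the inequality for `γ y`.
    · have h1 : dist (γ x) (γ y) ≤ φ.1 (G x) + φ.1 (G y) := φ.2.dist_le_add (G x) (G y)
      have h2 := (hγ x).apply_eq (hγ y).1
      have h3 := (γ y).2.dist_le_add x y
      simp only [g]
      linarith
    · have h1 : φ.1 (G x) + φ.1 (G y) = dist (γ x) (γ y) :=
        φ.2.add_eq_dist_of_antipodal fun r => (hγ x).dist_add_dist hxy (hγ y) (hcell r)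
      have h2 := (hγ x).apply_eq (hγ y).1
      have h3 := mem_tightSubspace.1 (hγ y).1 x y hxy
      simp only [g]
      linarith
  obtain ⟨g', hg', hgg'⟩ := hg
  refine ⟨⟨g', hg'⟩, Subtype.ext (funext fun q => ?_)⟩
  obtain ⟨x, hx⟩ := q.2
  rw [distToGates_apply hf _ _ hx]
  have hq : G x = q := Subtype.ext ((hγ x).unique hx)
  change g'.1 x - q.1.1 x = φ.1 q
  rw [hgg', ← hq]
  exact add_sub_cancel_right _ _

end Isometry

theorem theorem3 {X : Type*} [MetricSpace X]
    (hint : ∀ x y : X, ∃ n : ℤ, dist x y = n)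
    (hLRC : LocalRankCondition X)
    (f : InjHull X)
    (hgated : IsGated (InjHull.embed : X → InjHull X) (cell f)) :
    IsAntipodal (gates (InjHull.embed : X → InjHull X) (cell f)) ∧
    ∃ Φ : cell f ≃ᵢ InjHull (gates (InjHull.embed : X → InjHull X) (cell f)),
      (∀ (g : cell f) (x : X) (γ : gates (InjHull.embed : X → InjHull X) (cell f)),
        IsGate InjHull.embed (cell f) x γ.1 → (Φ g).1 γ = g.1.1 x - γ.1.1 x) ∧
      ∃ L : (X → ℝ) →ᵃ[ℝ] (gates (InjHull.embed : X → InjHull X) (cell f) → ℝ),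
        (∀ g : cell f, L g.1.1 = (Φ g).1) ∧
        IsPolytopeIso L (Subtype.val '' cell f)
          (Set.range fun h : InjHull (gates (InjHull.embed : X → InjHull X) (cell f)) => h.1) := by
  have hf := f.2.exists_tight hint hLRC
  refine ⟨isAntipodal_gates hf hgated,
    IsometryEquiv.mk (Equiv.ofBijective (distToGates hf hgated)
      ⟨(isometry_distToGates hf hgated).injective, surjective_distToGates hf hgated⟩)
      (isometry_distToGates hf hgated),
    fun g x γ h => distToGates_apply hf hgated g h, ?_⟩
  choose p hp using fun γ : gates (InjHull.embed : X → InjHull X) (cell f) => γ.2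
  let L : (X → ℝ) →ᵃ[ℝ] (gates (InjHull.embed : X → InjHull X) (cell f) → ℝ) :=
    (LinearMap.funLeft ℝ ℝ p).toAffineMap -
      AffineMap.const ℝ (X → ℝ)
        fun γ : gates (InjHull.embed : X → InjHull X) (cell f) => γ.1.1 (p γ)
  have hLapply : ∀ g γ, L g γ = g (p γ) - γ.1.1 (p γ) := fun g γ => rfl
  have hL : ∀ g : cell f, L g.1.1 = (distToGates hf hgated g).1 := fun g => funext fun γ => by
    rw [hLapply, distToGates_apply hf hgated g (hp γ)]
  -- An affine left inverse of `L` on the cell remains one on its affine hull.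
  have hinj : Set.InjOn L (affineSpan ℝ (Subtype.val '' cell f) : Set (X → ℝ)) := by
    choose γ hγ using fun x => hgated x
    let R : (gates (InjHull.embed : X → InjHull X) (cell f) → ℝ) →ᵃ[ℝ] (X → ℝ) :=
      (LinearMap.funLeft ℝ ℝ fun x => ⟨γ x, mem_gates (hγ x)⟩).toAffineMap +
        AffineMap.const ℝ _ fun x : X => (γ x).1 x
    have hRL : Set.EqOn (R.comp L) (AffineMap.id ℝ (X → ℝ)) (Subtype.val '' cell f) := by
      rintro _ ⟨g, hg, rfl⟩
      funext x
      have h1 : (R.comp L) g.1 x = L g.1 ⟨γ x, mem_gates (hγ x)⟩ + (γ x).1 x := rfl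
      rw [h1, hL ⟨g, hg⟩, distToGates_apply hf _ _ (hγ x)]
      exact sub_add_cancel _ _
    have hRL' := eqOn_affineSpan hRL
    intro g hg h hh hgh
    have h1 : R (L g) = g := hRL' hg
    have h2 : R (L h) = h := hRL' hh
    rw [← h1, ← h2, hgh]
  have himage : L '' (Subtype.val '' cell f) =
      Set.range fun h : InjHull (gates (InjHull.embed : X → InjHull X) (cell f)) => h.1 := by
    ext φ
    constructor
    · rintro ⟨_, ⟨g, hg, rfl⟩, rfl⟩
      exact ⟨distToGates hf hgated ⟨g, hg⟩, (hL ⟨g, hg⟩).symm⟩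
    · rintro ⟨φ, rfl⟩
      obtain ⟨g, rfl⟩ := surjective_distToGates hf hgated φ
      exact ⟨g.1.1, ⟨g.1, g.2, rfl⟩, hL g⟩
  have hpoly := isPolytope_image_val_cell hint hLRC f
  refine ⟨L, hL, hpoly, himage ▸ hpoly.affine_image L, hinj, himage, fun F hF => ?_⟩
  rw [← himage]
  exact isFace_image_iff L (convex_image_val_cell hf) (hinj.mono (subset_affineSpan ℝ _)) hF
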